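/- Let $\epsilon>0$, $\lambda\ge 0$, and let $K,d,N$ be natural numbers. A data set is a tuple $D=((x_i,y_i))_{i=1}^N$ with $x_i\in\mathbb R^d$ and labels $y_i\in[-1,1]$ (in particular $y_i\in\{-1,1\}$); two data sets are neighbours if they have the same size and differ in the value of at most one sample. A randomized mechanism $M$ is $\epsilon$-differentially private if $\Pr(M(D)\in T)\le e^{\epsilon}\Pr(M(D')\in T)$ for all neighbouring $D,D'$ and all measurable sets $T$ of outputs. *PLR.* Let $g:\mathbb R^m\to\mathbb R$ be a regularizer. Given $n\ge1$ samples $(x_i,y_i)$ in $\mathbb R^m\times[-1,1]$, put $\epsilon'=\epsilon-\log\bigl(1+\frac1{2n\lambda}+\frac1{16n^2\lambda^2}\bigr)$ (which is $-\infty$ if $\lambda=0$). If $\epsilon'>0$, let $\Delta=0$; otherwise let $\Delta=\frac{1}{4n(e^{\epsilon/4}-1)}-\lambda$ and reset $\epsilon'=\epsilon/2$. Scale every $x_i$ to norm at most $1$ by a fixed rule $x\mapsto c(x)x$, with $c>0$ measurable and $\|c(x)x\|\le1$, that is applied to each sample separately. Draw $b\in\mathbb R^m$ with density proportional to $\exp(-\epsilon'\|b\|/2)$,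 and output $$w=\arg\min_{w\in\mathbb R^m}\ \frac1n\sum_{i=1}^n\log\bigl(1+e^{-y_iw^\top x_i}\bigr)+\frac{b^\top w}{n}+\frac{\Delta\|w\|^2}{2}+\lambda g(w),$$ where the $x_i$ are the scaled samples. *PST-S.* Fix a partition of the index set $\{1,\dots,N\}$, not depending on the data, into non-empty sets; it splits $D$ into disjoint sets $\mathcal S_1,\dots,\mathcal S_K$ (low level) and $D^h$ (high level). Run PLR with budget $\epsilon$ and a regularizer $g$ on $\mathbb R^d$ independently on each $\mathcal S_k$, to get $w_1^l,\dots,w_K^l$. With $\sigma(a)=e^a/(1+e^a)$, form the meta-data set of all $\bigl([\sigma(x^\top w_1^l);\dots;\sigma(x^\top w_K^l)],\,y\bigr)$ with $(x,y)\in D^h$, and run PLR with budget $\epsilon$, a regularizer $g^h$ on $\mathbb R^K$ and fresh independent noise on it, to get $w^h$. Output $(w_1^l,\dots,w_K^l,w^h)$. **Proposition.** If the regularizers $g$ and $g^h$ are $1$-strongly convex, that is, $g(\alpha w+(1-\alpha)u)\le\alpha g(w)+(1-\alpha)g(u)-\frac12\alpha(1-\alpha)\|w-u\|^2$ for all $w,u$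 and $\alpha\in(0,1)$ (and likewise for $g^h$), then PST-S is $\epsilon$-differentially private: its joint output $(w_1^l,\dots,w_K^l,w^h)$ is an $\epsilon$-differentially private function of $D$. -/

import Mathlib

open MeasureTheory
open scoped ENNReal

namespace PrivStack

/-- The space `ℝ^d` with its Euclidean norm. -/
abbrev Vec (d : ℕ) : Type := EuclideanSpace ℝ (Fin d)

/-- A labelled sample `(x, y)` with `x ∈ ℝ^d` and `y ∈ [-1, 1]`; the class labels `y = ±1` are
the main case. -/
abbrev Sample (d : ℕ) : Type := Vec d × Set.Icc (-1 : ℝ) 1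

/-! ### Differential privacy -/

/-- Two data sets of the same size differ by (at most) one element. -/
def Neighbors {ι α : Type*} (D D' : ι → α) : Prop :=
  ∃ i, ∀ j, j ≠ i → D j = D' j

/-- A randomized mechanism `M`, given by the law `M D` of its output on each data set `D`, is
`ε`-differentially private: each `M D` is a probability law, and for neighbouring data sets
`Pr(M(D) ∈ T) ≤ e^ε Pr(M(D') ∈ T)` for every measurable set `T` of outputs. -/
def IsDifferentiallyPrivate {ι α β : Type*} [MeasurableSpace β] (ε : ℝ)
    (M : (ι → α) → Measure β) : Prop :=
  (∀ D, IsProbabilityMeasure (M D)) ∧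
    ∀ D D', Neighbors D D' → ∀ T : Set β, MeasurableSet T →
      M D T ≤ ENNReal.ofReal (Real.exp ε) * M D' T

/-! ### Privacy-preserving logistic regression (PLR) -/

/-- The logistic loss `ℓ(ŷ, y) = log (1 + e^(-y ŷ))`. -/
noncomputable def logisticLoss (yhat y : ℝ) : ℝ :=
  Real.log (1 + Real.exp (-(y * yhat)))

/-- A rule that scales each sample vector, on its own, into the unit ball: `x` is replaced by
`factor x • x`. For instance `factor x = 1 / max 1 ‖x‖`, or `factor x = 1 / R` for `‖x‖ ≤ R` with
a public bound `R`. -/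
structure ScalingRule (d : ℕ) where
  factor : Vec d → ℝ
  factor_pos : ∀ x, 0 < factor x
  measurable_factor : Measurable factor
  norm_le_one : ∀ x, ‖factor x • x‖ ≤ 1

/-- The scaled sample. -/
def ScalingRule.apply {d : ℕ} (s : ScalingRule d) (z : Sample d) : Sample d :=
  (s.factor z.1 • z.1, z.2)

/-- The test `ε - log (1 + 1/(2nλ) + 1/(16n²λ²)) > 0` of PLR. For `λ = 0` the left-hand side is
`-∞`, so that the test fails. -/
def SlackPositive (ε lam : ℝ) (n : ℕ) : Prop :=
  0 < lam ∧
    0 < ε - Real.log (1 + 1 / (2 * (n : ℝ) * lam) + 1 / (16 * (n : ℝ) ^ 2 * lam ^ 2))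

open Classical in
/-- The modified privacy budget `ε'` of PLR. -/
noncomputable def modifiedBudget (ε lam : ℝ) (n : ℕ) : ℝ :=
  if SlackPositive ε lam n then
    ε - Real.log (1 + 1 / (2 * (n : ℝ) * lam) + 1 / (16 * (n : ℝ) ^ 2 * lam ^ 2))
  else ε / 2

open Classical in
/-- The extra quadratic weight `Δ` of PLR. -/
noncomputable def extraWeight (ε lam : ℝ) (n : ℕ) : ℝ :=
  if SlackPositive ε lam n then 0
  else (4 * (n : ℝ) * (Real.exp (ε / 4) - 1))⁻¹ - lam

/-- The probability law on `ℝ^d` whose density is proportional to `exp (-c ‖b‖)`. -/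
noncomputable def expNormLaw (d : ℕ) (c : ℝ) : Measure (Vec d) :=
  (∫⁻ b : Vec d, ENNReal.ofReal (Real.exp (-(c * ‖b‖))))⁻¹ •
    (volume : Measure (Vec d)).withDensity
      (fun b => ENNReal.ofReal (Real.exp (-(c * ‖b‖))))

/-- The perturbed objective
`(1/n) ∑ ℓ(wᵀxᵢ, yᵢ) + bᵀw / n + Δ ‖w‖² / 2 + λ g(w)`, where `n` is the size of `D`. -/
noncomputable def objective {ι : Type} [Fintype ι] {d : ℕ} (lam Δ : ℝ) (g : Vec d → ℝ)
    (D : ι → Sample d) (b w : Vec d) : ℝ :=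
  1 / (Fintype.card ι : ℝ) * ∑ i, logisticLoss (inner ℝ w (D i).1) ((D i).2 : ℝ)
    + inner ℝ b w / (Fintype.card ι : ℝ) + Δ * ‖w‖ ^ 2 / 2 + lam * g w

/-- A global minimizer of `f` (arbitrary if there is none). -/
noncomputable def argmin {d : ℕ} (f : Vec d → ℝ) : Vec d :=
  Classical.epsilon fun w => ∀ v, f w ≤ f v

/-- PLR with privacy budget `ε`, hyperparameter `λ`, regularizer `g` and scaling rule `s`: the
law of the parameter vector that it outputs on the data set `D`. -/
noncomputable def plr {ι : Type} [Fintype ι] {d : ℕ} (ε lam : ℝ) (g : Vec d → ℝ)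
    (s : ScalingRule d) (D : ι → Sample d) : Measure (Vec d) :=
  (expNormLaw d (modifiedBudget ε lam (Fintype.card ι) / 2)).map fun b =>
    argmin (objective lam (extraWeight ε lam (Fintype.card ι)) g (fun i => s.apply (D i)) b)

/-! ### Privacy-preserving stacking with sample partitioning (PST-S)

The partition of the `N` samples is given by a map `part : Fin N → Option (Fin K)`: sample `i`
belongs to the high-level set if `part i = none`, and to the `k`-th low-level set if
`part i = some k`. -/

/-- The part of the data set `D` with label `p`. -/
def subData {N K : ℕ} {α : Type} (part : Fin N → Option (Fin K)) (p : Option (Fin K))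
    (D : Fin N → α) : {i : Fin N // part i = p} → α :=
  fun i => D i

/-- The meta-sample `([σ(xᵀw₁); …; σ(xᵀw_K)], y)` of a sample `(x, y)`. -/
noncomputable def metaSample {d K : ℕ} (w : Fin K → Vec d) (z : Sample d) : Sample K :=
  (WithLp.toLp 2 fun k => Real.sigmoid (inner ℝ z.1 (w k)), z.2)

/-- PST-S: the joint law of its output `((w₁, …, w_K), w_h)` on the data set `D`. The low-level
parameters come from independent runs of PLR on the low-level sets; given these parameters,
`w_h` comes from a fresh run of PLR on the meta-data set built from the high-level set. -/
noncomputable def pstS {N K d : ℕ} (ε lam : ℝ) (gLow : Vec d → ℝ) (gHigh : Vec K → ℝ)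
    (sLow : ScalingRule d) (sHigh : ScalingRule K) (part : Fin N → Option (Fin K))
    (D : Fin N → Sample d) : Measure ((Fin K → Vec d) × Vec K) :=
  (Measure.pi fun k : Fin K => plr ε lam gLow sLow (subData part (some k) D)).bind fun w =>
    (plr ε lam gHigh sHigh (fun i => metaSample w (subData part none D i))).map
      fun v => (w, v)

end PrivStack

/-! The partition is fixed and its blocks are disjoint, so a changed sample enters exactly one PLR
run directly; parallel composition costs `ε` once, provided each PLR run is `ε`-private.

For PLR, let `H` be the objective without the changed sample and without noise, strongly convex with
modulus `m = Δ + λ`. Adding the loss `L ⟪·, v⟫ / n` leaves the minimizer unchanged if the noise `b`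
is replaced by `b - p ⟪W b, v⟫ • v`, where `p = L'` and `W b` is the old minimizer
(`tiltedArgmin_addLoss`). This is a shear parallel to `v`, and on each line its slopes lie between
`1` and `1 + 1/(4nm)` (`hasSlopes_shift`). It therefore expands volume by a factor in that range
(`lintegral_shear`) and moves each point by at most `1`, which changes the density by at most
`e^(ε'/2)`. Deleting one sample and inserting another gives `e^ε' (1 + 1/(4nm))`, which `budget`
bounds by `e^ε`. Working line by line with Lipschitz bounds avoids Jacobians, so the regularizer
need not be differentiable. -/

namespace PrivStack

/-! ### Growth and existence of minimizers of strongly convex functions. -/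

section StrongConvexity

variable {E : Type*} [NormedAddCommGroup E] [NormedSpace ℝ E]

/-- Quadratic growth of a strongly convex function around a minimizer. -/
theorem quadratic_growth {m : ℝ} {f : E → ℝ} (hf : StrongConvexOn Set.univ m f) {w : E}
    (hw : ∀ v, f w ≤ f v) (u : E) : f w + m / 2 * ‖u - w‖ ^ 2 ≤ f u := by
  have key : ∀ a ∈ Set.Ioo (0 : ℝ) 1, f w + (1 - a) * (m / 2 * ‖u - w‖ ^ 2) ≤ f u := by
    intro a ⟨ha0, ha1⟩
    have h := hf.2 (Set.mem_univ u) (Set.mem_univ w) ha0.le (sub_nonneg.2 ha1.le)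
      (add_sub_cancel a 1)
    have h' := hw (a • u + (1 - a) • w)
    simp only [smul_eq_mul] at h
    have : a * (f w + (1 - a) * (m / 2 * ‖u - w‖ ^ 2)) ≤ a * f u := by linarith
    exact le_of_mul_le_mul_left this ha0
  -- Letting `a → 0` recovers the full constant `m / 2`.
  have hlim : Filter.Tendsto (fun a : ℝ => f w + (1 - a) * (m / 2 * ‖u - w‖ ^ 2))
      (nhdsWithin 0 (Set.Ioi 0)) (nhds (f w + (1 - 0) * (m / 2 * ‖u - w‖ ^ 2))) := by
    refine Filter.Tendsto.mono_left (Continuous.tendsto ?_ 0) nhdsWithin_le_nhds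
    fun_prop
  have := le_of_tendsto hlim
    (Filter.eventually_of_mem (Ioo_mem_nhdsGT (zero_lt_one' ℝ)) key)
  simpa using this

/-- A strongly convex function on a finite-dimensional space has a minimizer. -/
theorem exists_minimizer [FiniteDimensional ℝ E] {m : ℝ} (hm : 0 < m) {f : E → ℝ}
    (hf : StrongConvexOn Set.univ m f) : ∃ w, ∀ v, f w ≤ f v := by
  have hconv : ConvexOn ℝ Set.univ f := UniformConvexOn.convexOn hf fun r => by
    simpa using by positivity
  have hcont : Continuous f := hconv.locallyLipschitz.continuous
  have : ProperSpace E := FiniteDimensional.proper ℝ E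
  obtain ⟨z, -, hz⟩ := (isCompact_closedBall (0 : E) 1).exists_isMinOn
    ⟨0, by simp⟩ hcont.continuousOn
  -- The sublevel set of `f 0` is bounded: if `‖u‖ > 1`, strong convexity between `0` and `u`, used
  -- at `u / ‖u‖` where `f ≥ f z`, gives the stated radius.
  refine hcont.exists_forall_le_of_isBounded 0
    ((Metric.isBounded_closedBall (x := (0 : E)) (r := 1 + 2 * (f 0 - f z) / m)).subset ?_)
  intro u hu
  have hz0 : f z ≤ f 0 := hz (by simp)
  rw [mem_closedBall_zero_iff]
  rcases le_or_gt ‖u‖ 1 with h1 | h1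
  · have : 0 ≤ 2 * (f 0 - f z) / m := div_nonneg (by linarith) hm.le
    linarith
  · have hpos : 0 < ‖u‖ := by linarith
    have ha1 : ‖u‖⁻¹ ≤ 1 := inv_le_one_of_one_le₀ h1.le
    have h := hf.2 (Set.mem_univ u) (Set.mem_univ 0) (inv_nonneg.2 hpos.le)
      (sub_nonneg.2 ha1) (add_sub_cancel _ _)
    have hb : f z ≤ f (‖u‖⁻¹ • u) := hz (by simp [norm_smul, hpos.ne'])
    have hu' : f u ≤ f 0 := hu
    have h2 : ‖u‖⁻¹ * f u ≤ ‖u‖⁻¹ * f 0 := by gcongr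
    simp only [smul_eq_mul, smul_zero, add_zero, sub_zero] at h
    have h3 : ‖u‖⁻¹ * (1 - ‖u‖⁻¹) * (m / 2 * ‖u‖ ^ 2) = m / 2 * (‖u‖ - 1) := by
      field_simp
    rw [h3] at h
    have h4 : ‖u‖ - 1 ≤ 2 * (f 0 - f z) / m := by
      rw [le_div_iff₀ hm]
      nlinarith
    linarith

end StrongConvexity

/-! ### Stability and continuity of the minimizer. -/

section Argmin

variable {d : ℕ} {m : ℝ}

theorem argmin_le (hm : 0 < m) {f : Vec d → ℝ} (hf : StrongConvexOn Set.univ m f) (v : Vec d) :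
    f (argmin f) ≤ f v :=
  Classical.epsilon_spec (p := fun w => ∀ v, f w ≤ f v) (exists_minimizer hm hf) v

theorem argmin_growth (hm : 0 < m) {f : Vec d → ℝ} (hf : StrongConvexOn Set.univ m f)
    (u : Vec d) : f (argmin f) + m / 2 * ‖u - argmin f‖ ^ 2 ≤ f u :=
  quadratic_growth hf (argmin_le hm hf) u

theorem argmin_eq (hm : 0 < m) {f : Vec d → ℝ} (hf : StrongConvexOn Set.univ m f) {w : Vec d}
    (hw : ∀ v, f w ≤ f v) : argmin f = w := by
  have h1 := argmin_growth hm hf w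
  have h2 := hw (argmin f)
  have h3 : ‖w - argmin f‖ ^ 2 ≤ 0 := by
    by_contra! h
    have : 0 < m / 2 * ‖w - argmin f‖ ^ 2 := by positivity
    linarith
  have h4 : ‖w - argmin f‖ = 0 := by
    simpa using le_antisymm h3 (sq_nonneg _)
  rw [norm_sub_eq_zero_iff] at h4
  exact h4.symm

/-- Stability of minimizers under a perturbation of linear growth. -/
theorem argmin_stability (hm : 0 < m) {f f' : Vec d → ℝ} (hf : StrongConvexOn Set.univ m f)
    (hf' : StrongConvexOn Set.univ m f') {η : ℝ} (h : ∀ u, |f u - f' u| ≤ η * ‖u‖) :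
    m * ‖argmin f' - argmin f‖ ^ 2
      ≤ η * (2 * ‖argmin f‖ + ‖argmin f' - argmin f‖) := by
  -- Each growth inequality is taken at the other function's minimizer; in the sum only differences
  -- `f - f'` survive.
  have h1 := argmin_growth hm hf (argmin f')
  have h2 := argmin_growth hm hf' (argmin f)
  rw [norm_sub_rev] at h2
  have h3 := abs_le.1 (h (argmin f))
  have h4 := abs_le.1 (h (argmin f'))
  have h5 : ‖argmin f'‖ ≤ ‖argmin f‖ + ‖argmin f' - argmin f‖ := norm_le_norm_add_norm_sub' _ _
  by_cases hη : 0 ≤ η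
  · nlinarith
  -- A negative `η` is possible only in the zero space.
  · have h6 : ∀ u : Vec d, ‖u‖ = 0 := fun u => by
      have := (abs_nonneg _).trans (h u)
      nlinarith [norm_nonneg u]
    simp [h6]

/-- A family of strongly convex functions with a common modulus has a continuous minimizer if
nearby members of the family differ by a function of small linear growth. -/
theorem continuous_argmin {X : Type*} [TopologicalSpace X] (hm : 0 < m) {F : X → Vec d → ℝ}
    (hF : ∀ x, StrongConvexOn Set.univ m (F x)) (η : X → X → ℝ)
    (hη : ∀ x x' u, |F x u - F x' u| ≤ η x x' * ‖u‖)
    (hη0 : ∀ x, Filter.Tendsto (η x) (nhds x) (nhds 0)) :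
    Continuous fun x => argmin (F x) := by
  rw [continuous_iff_continuousAt]
  intro x
  have hbd : ∀ᶠ x' in nhds x, ‖argmin (F x') - argmin (F x)‖ ^ 2
      ≤ (2 * |η x x'| * (2 * ‖argmin (F x)‖)) / m + (|η x x'| / m) ^ 2 := by
    refine Filter.Eventually.of_forall fun x' => ?_
    have h := argmin_stability hm (hF x) (hF x') (hη x x')
    set r := ‖argmin (F x') - argmin (F x)‖
    set a := ‖argmin (F x)‖
    have ha : 0 ≤ a := norm_nonneg _
    have hr : 0 ≤ r := norm_nonneg _
    have h2 : m * r ^ 2 ≤ |η x x'| * (2 * a + r) :=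
      h.trans (mul_le_mul_of_nonneg_right (le_abs_self _) (by positivity))
    have h3 : r ^ 2 ≤ (|η x x'| / m) * (2 * a + r) := by
      rw [div_mul_eq_mul_div, le_div_iff₀ hm]; linarith
    have h4 : 2 * |η x x'| * (2 * a) / m = 2 * (|η x x'| / m) * (2 * a) := by ring
    rw [h4]
    -- The cross term `r * (|η| / m)` is absorbed into the left side by `2ab ≤ a² + b²`.
    nlinarith [sq_nonneg (r - |η x x'| / m)]
  have hlim : Filter.Tendsto (fun x' => (2 * |η x x'| * (2 * ‖argmin (F x)‖)) / m
      + (|η x x'| / m) ^ 2) (nhds x) (nhds 0) := by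
    have h0 : Filter.Tendsto (fun x' => |η x x'|) (nhds x) (nhds 0) := by
      simpa using (hη0 x).abs
    have := (((h0.const_mul 2).mul_const (2 * ‖argmin (F x)‖)).div_const m).add
      ((h0.div_const m).pow 2)
    simpa using this
  have hsq := squeeze_zero' (Filter.Eventually.of_forall fun x' => sq_nonneg _) hbd hlim
  rw [ContinuousAt, tendsto_iff_norm_sub_tendsto_zero]
  have := hsq.sqrt
  simpa [Real.sqrt_sq] using this

end Argmin

/-! ### Change of variables for shears, without derivatives. -/

section ChangeOfVariables

open Module

/-- `φ` is increasing with slopes between `1` and `K`. -/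
structure HasSlopes (K : NNReal) (φ : ℝ → ℝ) : Prop where
  lower : ∀ s t, s ≤ t → t - s ≤ φ t - φ s
  upper : ∀ s t, s ≤ t → φ t - φ s ≤ K * (t - s)

namespace HasSlopes

variable {K : NNReal} {φ : ℝ → ℝ}

theorem lipschitzWith (h : HasSlopes K φ) : LipschitzWith K φ := by
  refine LipschitzWith.of_dist_le_mul fun s t => ?_
  wlog hst : s ≤ t generalizing s t
  · rw [dist_comm, dist_comm s]; exact this t s (le_of_not_ge hst)
  rw [dist_comm, dist_comm s, Real.dist_eq, Real.dist_eq, abs_of_nonneg (sub_nonneg.2 hst),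
    abs_of_nonneg ((sub_nonneg.2 hst).trans (h.lower s t hst))]
  exact h.upper s t hst

theorem antilipschitzWith (h : HasSlopes K φ) : AntilipschitzWith 1 φ := by
  refine AntilipschitzWith.of_le_mul_dist fun s t => ?_
  wlog hst : s ≤ t generalizing s t
  · rw [dist_comm, dist_comm (φ s)]; exact this t s (le_of_not_ge hst)
  rw [dist_comm, dist_comm (φ s), Real.dist_eq, Real.dist_eq, abs_of_nonneg (sub_nonneg.2 hst),
    abs_of_nonneg ((sub_nonneg.2 hst).trans (h.lower s t hst))]
  simpa using h.lower s t hst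

theorem surjective (h : HasSlopes K φ) : Function.Surjective φ := by
  refine h.lipschitzWith.continuous.surjective ?_ ?_
  · refine Filter.tendsto_atTop_mono' (f₁ := fun t => φ 0 + t) _ ?_
      (Filter.tendsto_atTop_add_const_left _ _ Filter.tendsto_id)
    filter_upwards [Filter.eventually_ge_atTop 0] with t ht
    linarith [h.lower 0 t ht]
  · refine Filter.tendsto_atBot_mono' _ ?_
      (Filter.tendsto_atBot_add_const_left _ (φ 0) Filter.tendsto_id)
    filter_upwards [Filter.eventually_le_atBot 0] with t ht
    simp only [id]
    linarith [h.lower t 0 ht]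

/-- Lebesgue measure on the line is one-dimensional Hausdorff measure, so the metric bounds on `φ`
directly become measure bounds here and in `volume_le_smul_map`. -/
theorem map_volume_le (h : HasSlopes K φ) : (volume : Measure ℝ).map φ ≤ volume := by
  refine Measure.le_iff.2 fun s hs => ?_
  rw [Measure.map_apply h.lipschitzWith.continuous.measurable hs]
  simpa [hausdorffMeasure_real] using
    h.antilipschitzWith.hausdorffMeasure_preimage_le zero_le_one s

theorem volume_le_smul_map (h : HasSlopes K φ) :
    (volume : Measure ℝ) ≤ (K : ℝ≥0∞) • (volume : Measure ℝ).map φ := by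
  refine Measure.le_iff.2 fun s hs => ?_
  rw [Measure.smul_apply, Measure.map_apply h.lipschitzWith.continuous.measurable hs, smul_eq_mul]
  have := h.lipschitzWith.hausdorffMeasure_image_le zero_le_one (φ ⁻¹' s)
  rw [Set.image_preimage_eq s h.surjective] at this
  simpa [hausdorffMeasure_real] using this

theorem lintegral_comp_le (h : HasSlopes K φ) {G : ℝ → ℝ≥0∞} (hG : Measurable G) :
    ∫⁻ t, G (φ t) ≤ ∫⁻ t, G t := by
  rw [← lintegral_map hG h.lipschitzWith.continuous.measurable]
  exact lintegral_mono' h.map_volume_le le_rfl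

theorem lintegral_le_comp (h : HasSlopes K φ) {G : ℝ → ℝ≥0∞} (hG : Measurable G) :
    ∫⁻ t, G t ≤ K * ∫⁻ t, G (φ t) := by
  rw [← lintegral_map hG h.lipschitzWith.continuous.measurable, ← smul_eq_mul, ← lintegral_smul_measure]
  exact lintegral_mono' h.volume_le_smul_map le_rfl

end HasSlopes

variable {E : Type*} [NormedAddCommGroup E] [NormedSpace ℝ E] [FiniteDimensional ℝ E]
  [MeasurableSpace E] [BorelSpace E] (μ : Measure E) [μ.IsAddHaarMeasure]

/-- Integration along the lines parallel to a given vector. -/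
theorem exists_lintegral_eq_lines {v : E} (hv : v ≠ 0) :
    ∃ (n : ℕ) (j : (Fin n → ℝ) → E) (c : ℝ≥0∞), Measurable j ∧
      ∀ F : E → ℝ≥0∞, Measurable F →
        ∫⁻ b, F b ∂μ = c * ∫⁻ x, ∫⁻ t : ℝ, F (j x + t • v) := by
  have : Nontrivial E := nontrivial_iff.2 ⟨v, 0, hv⟩
  let n := finrank ℝ E
  let E' := Fin (n - 1) → ℝ
  obtain ⟨L, hL⟩ : ∃ L : E ≃L[ℝ] (E' × ℝ), L v = (0, 1) := by
    have : finrank ℝ (E' × ℝ) = n := by simpa [this, E'] using Nat.sub_add_cancel finrank_pos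
    have L₀ : E ≃L[ℝ] (E' × ℝ) := (ContinuousLinearEquiv.ofFinrankEq this).symm
    obtain ⟨M, hM⟩ : ∃ M : (E' × ℝ) ≃L[ℝ] (E' × ℝ), M (L₀ v) = (0, 1) := by
      apply SeparatingDual.exists_continuousLinearEquiv_apply_eq
      · simpa using hv
      · simp
    exact ⟨L₀.trans M, by simp [hM]⟩
  have hLs : Measurable L.symm := L.symm.continuous.measurable
  let ν : Measure E := ((volume : Measure E').prod (volume : Measure ℝ)).map L.symm
  have : ν.IsAddHaarMeasure := L.symm.isAddHaarMeasure_map _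
  refine ⟨n - 1, fun x => L.symm (x, 0), μ.addHaarScalarFactor ν,
    hLs.comp (by fun_prop), fun F hF => ?_⟩
  -- In coordinates where `v` is the last basis vector, uniqueness of Haar measure supplies `c` and
  -- Tonelli the iterated integral.
  have hμ := Measure.isAddLeftInvariant_eq_smul μ ν
  set c := μ.addHaarScalarFactor ν
  rw [hμ, lintegral_smul_measure, lintegral_map hF hLs,
    lintegral_prod (fun z => F (L.symm z)) (hF.comp hLs).aemeasurable]
  rw [ENNReal.smul_def, smul_eq_mul]
  have hlin : ∀ (x : E') (t : ℝ), L.symm (x, t) = L.symm (x, 0) + t • v := fun x t => by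
    apply L.injective
    simp [hL]
  exact congrArg (_ * ·) (lintegral_congr fun x => lintegral_congr fun t => by rw [hlin])

/-- A shear `b ↦ b + f b • v` whose restrictions to the lines parallel to `v` have slopes between
`1` and `K` increases volumes, by at most the factor `K`. -/
theorem lintegral_shear {v : E} {f : E → ℝ} (hf : Measurable f) {K : NNReal}
    (hs : ∀ b, HasSlopes K fun t => t + f (b + t • v)) (hK : 1 ≤ K) {F : E → ℝ≥0∞}
    (hF : Measurable F) :
    ∫⁻ b, F (b + f b • v) ∂μ ≤ ∫⁻ b, F b ∂μ ∧
      ∫⁻ b, F b ∂μ ≤ K * ∫⁻ b, F (b + f b • v) ∂μ := by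
  have hK' : (1 : ℝ≥0∞) ≤ K := by exact_mod_cast hK
  rcases eq_or_ne v 0 with rfl | hv
  · simp only [smul_zero, add_zero, le_refl, true_and]
    exact le_mul_of_one_le_left' hK'
  obtain ⟨n, j, c, hj, hline⟩ := exists_lintegral_eq_lines μ hv
  have hFf : Measurable fun b => F (b + f b • v) :=
    hF.comp (measurable_id.add (hf.smul_const v))
  rw [hline F hF, hline _ hFf]
  have hrw : ∀ (x : Fin n → ℝ) (t : ℝ), F (j x + t • v + f (j x + t • v) • v)
      = F (j x + (t + f (j x + t • v)) • v) := fun x t => by rw [add_smul, add_assoc]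
  simp only [hrw]
  have hG : ∀ x, Measurable fun t : ℝ => F (j x + t • v) := fun x => hF.comp (by fun_prop)
  constructor
  · refine mul_le_mul_right (lintegral_mono fun x => ?_) c
    exact (hs (j x)).lintegral_comp_le (hG x)
  · rw [mul_left_comm, ← lintegral_const_mul' _ _ ENNReal.coe_ne_top]
    refine mul_le_mul_right (lintegral_mono fun x => ?_) c
    exact (hs (j x)).lintegral_le_comp (hG x)

end ChangeOfVariables

/-! ### Derivative bounds for the logistic loss. -/

section LogisticLoss

/-- `L` is a convex loss with derivative `p`, where `p` is bounded by `1` and has slopes between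
`0` and `1/4`. -/
structure IsSmoothLoss (L p : ℝ → ℝ) : Prop where
  convex : ConvexOn ℝ Set.univ L
  tangent : ∀ s t, L t + p t * (s - t) ≤ L s
  bound : ∀ t, |p t| ≤ 1
  mono : Monotone p
  slope_le : ∀ s t, s ≤ t → p t - p s ≤ (t - s) / 4

theorem hasDerivAt_logisticLoss (y a : ℝ) :
    HasDerivAt (fun a => logisticLoss a y) (-(y * Real.sigmoid (-(y * a)))) a := by
  have h1 : HasDerivAt (fun a : ℝ => -(y * a)) (-y) a := by
    simpa using (hasDerivAt_const_mul (x := a) y).fun_neg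
  have h2 := (h1.exp.const_add 1).log (by positivity)
  convert! h2 using 1
  rw [Real.sigmoid_def, neg_neg, Real.exp_neg]
  have : 0 < Real.exp (y * a) := Real.exp_pos _
  field_simp
  ring

theorem hasDerivAt_logisticLoss_deriv (y a : ℝ) :
    HasDerivAt (fun a => -(y * Real.sigmoid (-(y * a))))
      (y ^ 2 * (Real.sigmoid (-(y * a)) * (1 - Real.sigmoid (-(y * a))))) a := by
  have h1 : HasDerivAt (fun a : ℝ => -(y * a)) (-y) a := by
    simpa using (hasDerivAt_const_mul (x := a) y).fun_neg
  have h2 := (((Real.hasDerivAt_sigmoid (-(y * a))).comp a h1).const_mul y).neg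
  convert! h2 using 1
  ring

/-- The second derivative is `y² σ (1 - σ)`, which lies in `[0, 1/4]` because `|y| ≤ 1`. -/
theorem isSmoothLoss_logisticLoss {y : ℝ} (hy : y ∈ Set.Icc (-1 : ℝ) 1) :
    IsSmoothLoss (fun a => logisticLoss a y) fun a => -(y * Real.sigmoid (-(y * a))) := by
  have hdiff : Differentiable ℝ fun a => -(y * Real.sigmoid (-(y * a))) :=
    fun a => (hasDerivAt_logisticLoss_deriv y a).differentiableAt
  have hσ : ∀ a, 0 ≤ Real.sigmoid a ∧ Real.sigmoid a ≤ 1 := fun a =>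
    ⟨Real.sigmoid_nonneg a, Real.sigmoid_le_one a⟩
  have hy1 : |y| ≤ 1 := abs_le.2 hy
  have hy2 : y ^ 2 ≤ 1 := (sq_le_one_iff_abs_le_one y).2 hy1
  have hmono : Monotone fun a => -(y * Real.sigmoid (-(y * a))) := by
    refine monotone_of_deriv_nonneg hdiff fun a => ?_
    rw [(hasDerivAt_logisticLoss_deriv y a).deriv]
    have := hσ (-(y * a))
    exact mul_nonneg (sq_nonneg _) (mul_nonneg this.1 (by linarith))
  have hconv : ConvexOn ℝ Set.univ fun a => logisticLoss a y := by
    refine Monotone.convexOn_univ_of_deriv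
      (fun a => (hasDerivAt_logisticLoss y a).differentiableAt) ?_
    rw [show deriv (fun a => logisticLoss a y) = fun a => -(y * Real.sigmoid (-(y * a))) from
      funext fun a => (hasDerivAt_logisticLoss y a).deriv]
    exact hmono
  refine ⟨hconv, fun s t => ?_, fun t => ?_, hmono, fun s t hst => ?_⟩
  · rcases lt_trichotomy t s with h | rfl | h
    · have := hconv.le_slope_of_hasDerivAt (Set.mem_univ t) (Set.mem_univ s) h
        (hasDerivAt_logisticLoss y t)
      rw [slope_def_field, le_div_iff₀ (sub_pos.2 h)] at this
      linarith
    · simp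
    · have := hconv.slope_le_of_hasDerivAt (Set.mem_univ s) (Set.mem_univ t) h
        (hasDerivAt_logisticLoss y t)
      rw [slope_def_field, div_le_iff₀ (sub_pos.2 h)] at this
      linarith
  · rw [abs_neg, abs_mul, abs_of_nonneg (hσ _).1]
    exact mul_le_one₀ hy1 (hσ _).1 (hσ _).2
  · have h := convex_univ.image_sub_le_mul_sub_of_deriv_le (C := 1 / 4)
      hdiff.continuous.continuousOn hdiff.differentiableOn (fun a _ => by
        rw [(hasDerivAt_logisticLoss_deriv y a).deriv]
        set σ := Real.sigmoid (-(y * a))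
        have h0 := hσ (-(y * a))
        have h1 : 0 ≤ σ * (1 - σ) := mul_nonneg h0.1 (by linarith [h0.2])
        have h2 : σ * (1 - σ) ≤ 1 / 4 := by nlinarith [sq_nonneg (σ - 1 / 2)]
        nlinarith) s (Set.mem_univ s) t (Set.mem_univ t) hst
    linarith

theorem IsSmoothLoss.abs_sub_le {L p : ℝ → ℝ} (h : IsSmoothLoss L p) (s t : ℝ) :
    |L s - L t| ≤ |s - t| := by
  have h1 : |p s * (s - t)| ≤ |s - t| := by
    rw [abs_mul]; exact mul_le_of_le_one_left (abs_nonneg _) (h.bound s)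
  have h2 : |p t * (s - t)| ≤ |s - t| := by
    rw [abs_mul]; exact mul_le_of_le_one_left (abs_nonneg _) (h.bound t)
  have h3 := h.tangent s t
  have h4 := h.tangent t s
  rw [abs_le] at *
  constructor <;> linarith

end LogisticLoss

/-! ### The exponential noise law. -/

section NoiseLaw

variable {d : ℕ} {c : ℝ}

theorem lintegral_exp_norm_ne_zero :
    (∫⁻ b : Vec d, ENNReal.ofReal (Real.exp (-(c * ‖b‖)))) ≠ 0 := by
  intro h
  rw [lintegral_eq_zero_iff (by fun_prop)] at h
  obtain ⟨b, hb⟩ := h.exists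
  exact (ENNReal.ofReal_pos.2 (Real.exp_pos _)).ne' hb

theorem lintegral_exp_norm_ne_top (hc : 0 < c) :
    (∫⁻ b : Vec d, ENNReal.ofReal (Real.exp (-(c * ‖b‖)))) ≠ ∞ := by
  have hint : Integrable fun b : Vec d => (1 + ‖b‖) ^ (-((d + 1 : ℕ) : ℝ)) :=
    integrable_one_add_norm (by simp)
  refine ((hint.const_mul (Real.exp c * (d + 1).factorial / c ^ (d + 1))).mono'
    (f := fun b : Vec d => Real.exp (-(c * ‖b‖))) ?_ ?_).lintegral_lt_top.ne
  · exact Measurable.aestronglyMeasurable (by fun_prop)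
  refine Filter.Eventually.of_forall fun b => ?_
  have hb : 0 < 1 + ‖b‖ := by positivity
  -- The term of degree `d + 1` of the exponential series gives a polynomial decay integrable in
  -- dimension `d`.
  have h := Real.pow_div_factorial_le_exp (c * (1 + ‖b‖)) (by positivity) (d + 1)
  rw [Real.norm_eq_abs, Real.abs_exp, Real.rpow_neg hb.le, Real.rpow_natCast, Real.exp_neg]
  rw [mul_add, mul_one, Real.exp_add] at h
  have he := Real.exp_pos (c * ‖b‖)
  rw [← mul_one_add, mul_pow, div_le_iff₀ (by positivity)] at h
  rw [← div_eq_mul_inv, div_div, le_div_iff₀ (by positivity), inv_mul_le_iff₀ he]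
  linarith

theorem isProbabilityMeasure_expNormLaw (hc : 0 < c) :
    IsProbabilityMeasure (expNormLaw d c) := by
  constructor
  rw [expNormLaw, Measure.smul_apply, withDensity_apply _ MeasurableSet.univ, Measure.restrict_univ,
    smul_eq_mul]
  exact ENNReal.inv_mul_cancel lintegral_exp_norm_ne_zero (lintegral_exp_norm_ne_top hc)

theorem expNormLaw_apply {s : Set (Vec d)} (hs : MeasurableSet s) :
    expNormLaw d c s = (∫⁻ b : Vec d, ENNReal.ofReal (Real.exp (-(c * ‖b‖))))⁻¹ *
      ∫⁻ b, s.indicator (fun b => ENNReal.ofReal (Real.exp (-(c * ‖b‖)))) b := by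
  rw [expNormLaw, Measure.smul_apply, withDensity_apply _ hs, smul_eq_mul, lintegral_indicator hs]

theorem exp_norm_le (hc : 0 ≤ c) {a b : Vec d} (h : ‖a - b‖ ≤ 1) :
    ENNReal.ofReal (Real.exp (-(c * ‖a‖)))
      ≤ ENNReal.ofReal (Real.exp c) * ENNReal.ofReal (Real.exp (-(c * ‖b‖))) := by
  rw [← ENNReal.ofReal_mul (Real.exp_pos _).le, ← Real.exp_add]
  refine ENNReal.ofReal_le_ofReal (Real.exp_le_exp.2 ?_)
  have : ‖b‖ ≤ ‖a‖ + 1 := by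
    have := norm_le_norm_add_norm_sub a b
    linarith
  nlinarith

end NoiseLaw
-- Effect of one additional loss on the law of the minimizer.
section AddLoss

variable {d : ℕ}

/-- The minimizer of `H + ⟪b, ·⟫ / n`, as a function of `b`. -/
noncomputable def tiltedArgmin (n : ℝ) (H : Vec d → ℝ) (b : Vec d) : Vec d :=
  argmin fun u => H u + inner ℝ b u / n

variable {n m : ℝ} {H : Vec d → ℝ}

theorem convexOn_inner_div (b : Vec d) (n : ℝ) :
    ConvexOn ℝ Set.univ fun u : Vec d => inner ℝ b u / n := by
  refine ⟨convex_univ, fun x _ y _ s t _ _ _ => le_of_eq ?_⟩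
  simp only [inner_add_right, inner_smul_right, smul_eq_mul]
  ring

theorem StrongConvexOn.add_convexOn (hH : StrongConvexOn Set.univ m H) {f : Vec d → ℝ}
    (hf : ConvexOn ℝ Set.univ f) : StrongConvexOn Set.univ m fun u => H u + f u := by
  have h := UniformConvexOn.add hH (uniformConvexOn_zero.2 hf)
  rw [add_zero] at h
  exact h

theorem strongConvexOn_tilt (hH : StrongConvexOn Set.univ m H) (b : Vec d) :
    StrongConvexOn Set.univ m fun u => H u + inner ℝ b u / n :=
  StrongConvexOn.add_convexOn hH (convexOn_inner_div b n)

theorem continuous_tiltedArgmin (hm : 0 < m) (hn : 0 < n) (hH : StrongConvexOn Set.univ m H) :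
    Continuous (tiltedArgmin n H) := by
  refine continuous_argmin hm (strongConvexOn_tilt hH) (fun b b' => ‖b - b'‖ / n)
    (fun b b' u => ?_) fun b => ?_
  · rw [add_sub_add_left_eq_sub, ← sub_div, ← inner_sub_left, abs_div, abs_of_pos hn,
      div_mul_eq_mul_div]
    gcongr
    exact abs_real_inner_le_norm _ _
  · have : Continuous fun b' => ‖b - b'‖ / n := by fun_prop
    simpa using this.tendsto b

/-- Adding the growth inequalities for `b` and `b'` cancels `H`. The result controls both the sign
and the size of the minimizer's response to noise. -/
theorem tiltedArgmin_monotone (hm : 0 < m) (hn : 0 < n) (hH : StrongConvexOn Set.univ m H)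
    (b b' : Vec d) :
    n * m * ‖tiltedArgmin n H b' - tiltedArgmin n H b‖ ^ 2
      ≤ -inner ℝ (b' - b) (tiltedArgmin n H b' - tiltedArgmin n H b) := by
  have h1 := argmin_growth hm (strongConvexOn_tilt (n := n) hH b) (tiltedArgmin n H b')
  have h2 := argmin_growth hm (strongConvexOn_tilt (n := n) hH b') (tiltedArgmin n H b)
  rw [← tiltedArgmin] at h1 h2
  rw [norm_sub_rev] at h2
  simp only [inner_sub_left, inner_sub_right]
  have h3 : m * ‖tiltedArgmin n H b' - tiltedArgmin n H b‖ ^ 2 ≤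
      (inner ℝ b (tiltedArgmin n H b') + inner ℝ b' (tiltedArgmin n H b)
        - inner ℝ b (tiltedArgmin n H b) - inner ℝ b' (tiltedArgmin n H b')) / n := by
    simp only [sub_div, add_div]
    linarith
  rw [le_div_iff₀ hn] at h3
  linarith

variable {L p : ℝ → ℝ} {v : Vec d}

theorem IsSmoothLoss.convexOn_comp_inner (hL : IsSmoothLoss L p) (v : Vec d) (hn : 0 < n) :
    ConvexOn ℝ Set.univ fun u : Vec d => L (inner ℝ u v) / n := by
  refine ⟨convex_univ, fun x _ y _ s t hs ht hst => ?_⟩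
  have := hL.convex.2 (Set.mem_univ (inner ℝ x v)) (Set.mem_univ (inner ℝ y v)) hs ht hst
  simp only [inner_add_left, real_inner_smul_left, smul_eq_mul] at this ⊢
  rw [← mul_div_assoc, ← mul_div_assoc, ← add_div]
  gcongr

theorem strongConvexOn_addLoss (hn : 0 < n) (hH : StrongConvexOn Set.univ m H)
    (hL : IsSmoothLoss L p) (v : Vec d) :
    StrongConvexOn Set.univ m fun u => H u + L (inner ℝ u v) / n :=
  StrongConvexOn.add_convexOn hH (hL.convexOn_comp_inner v hn)

/-- Adding a loss to the objective amounts to shifting the noise vector. -/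
theorem tiltedArgmin_addLoss (hm : 0 < m) (hn : 0 < n) (hH : StrongConvexOn Set.univ m H)
    (hL : IsSmoothLoss L p) (v b : Vec d) :
    tiltedArgmin n (fun u => H u + L (inner ℝ u v) / n)
      (b + (-p (inner ℝ (tiltedArgmin n H b) v)) • v) = tiltedArgmin n H b := by
  refine argmin_eq hm (strongConvexOn_tilt (strongConvexOn_addLoss hn hH hL v) _) fun u => ?_
  have h1 : H (tiltedArgmin n H b) + _ ≤ _ := argmin_le hm (strongConvexOn_tilt (n := n) hH b) u
  rw [← tiltedArgmin] at h1
  set w := tiltedArgmin n H b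
  -- Convexity replaces the loss by its tangent at `w`, whose linear part is exactly cancelled by
  -- the shift of the noise.
  have h2 := hL.tangent (inner ℝ u v) (inner ℝ w v)
  have h3 := div_le_div_of_nonneg_right h2 hn.le
  simp only [inner_add_left, real_inner_smul_left, real_inner_comm v] at *
  simp only [add_div, mul_sub, sub_div, neg_mul, neg_div] at *
  linarith

/-- Along `v`, the quantity `⟪W (b + t • v), v⟫` decreases at rate at most `1/(nm)`, and `p` is
increasing with slope at most `1/4`. -/
theorem hasSlopes_shift (hm : 0 < m) (hn : 0 < n) (hH : StrongConvexOn Set.univ m H)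
    (hL : IsSmoothLoss L p) (hv : ‖v‖ ≤ 1) (b : Vec d) :
    HasSlopes (1 + (4 * n * m)⁻¹).toNNReal
      fun t => t + (-p (inner ℝ (tiltedArgmin n H (b + t • v)) v)) := by
  have key : ∀ s t : ℝ, s < t →
      inner ℝ (tiltedArgmin n H (b + t • v)) v ≤ inner ℝ (tiltedArgmin n H (b + s • v)) v ∧
      inner ℝ (tiltedArgmin n H (b + s • v)) v - inner ℝ (tiltedArgmin n H (b + t • v)) v
        ≤ (t - s) / (n * m) := by
    intro s t hst
    have h := tiltedArgmin_monotone hm hn hH (b + s • v) (b + t • v)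
    have hsub : b + t • v - (b + s • v) = (t - s) • v := by rw [sub_smul]; abel
    rw [hsub, real_inner_smul_left, real_inner_comm] at h
    have hcs := abs_real_inner_le_norm
      (tiltedArgmin n H (b + t • v) - tiltedArgmin n H (b + s • v)) v
    rw [inner_sub_left] at h hcs
    set q := inner ℝ (tiltedArgmin n H (b + s • v)) v - inner ℝ (tiltedArgmin n H (b + t • v)) v
      with hq
    set r := ‖tiltedArgmin n H (b + t • v) - tiltedArgmin n H (b + s • v)‖
    have hr : 0 ≤ r := norm_nonneg _
    have hnm : 0 < n * m := mul_pos hn hm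
    have hst' : 0 < t - s := sub_pos.2 hst
    have h' : n * m * r ^ 2 ≤ (t - s) * q := by rw [hq]; linarith
    have hq0 : 0 ≤ q := by
      by_contra! hneg
      have : (t - s) * q < 0 := mul_neg_of_pos_of_neg hst' hneg
      have : 0 ≤ n * m * r ^ 2 := by positivity
      linarith
    have hqr : q ≤ r := by
      have h1 := (abs_le.1 hcs).1
      have h2 : r * ‖v‖ ≤ r := mul_le_of_le_one_right hr hv
      linarith
    refine ⟨by linarith, ?_⟩
    rw [le_div_iff₀ hnm]
    rcases hq0.eq_or_lt with h0 | h0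
    · rw [← h0]; linarith
    · have h1 : n * m * q ^ 2 ≤ n * m * r ^ 2 := by gcongr
      have h2 : q * (q * (n * m)) ≤ q * (t - s) := by linarith
      exact le_of_mul_le_mul_left h2 h0
  have hpos : 0 < (4 * n * m)⁻¹ := by positivity
  constructor
  · intro s t hst
    rcases hst.eq_or_lt with rfl | hst
    · simp
    have := hL.mono (key s t hst).1
    linarith
  · intro s t hst
    rw [Real.coe_toNNReal _ (by positivity)]
    rcases hst.eq_or_lt with rfl | hst
    · simp
    have h1 := hL.slope_le _ _ (key s t hst).1
    have h2 := (key s t hst).2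
    have h3 : (1 + (4 * n * m)⁻¹) * (t - s) = (t - s) + (t - s) / (n * m) / 4 := by
      field_simp
    rw [h3]
    linarith

/-- The effect of a single loss on the law of the minimizer under exponential noise. -/
theorem map_tiltedArgmin_addLoss (hm : 0 < m) (hn : 0 < n) (hH : StrongConvexOn Set.univ m H)
    (hL : IsSmoothLoss L p) (hv : ‖v‖ ≤ 1) {c : ℝ} (hc : 0 ≤ c) {T : Set (Vec d)}
    (hT : MeasurableSet T) :
    (expNormLaw d c).map (tiltedArgmin n H) T ≤ ENNReal.ofReal (Real.exp c) *
        (expNormLaw d c).map (tiltedArgmin n fun u => H u + L (inner ℝ u v) / n) T ∧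
      (expNormLaw d c).map (tiltedArgmin n fun u => H u + L (inner ℝ u v) / n) T ≤
        ENNReal.ofReal (1 + (4 * n * m)⁻¹) * (ENNReal.ofReal (Real.exp c) *
          (expNormLaw d c).map (tiltedArgmin n H) T) := by
  have hW0 := (continuous_tiltedArgmin hm hn hH).measurable
  have hW1 := (continuous_tiltedArgmin hm hn (strongConvexOn_addLoss hn hH hL v)).measurable
  have hψ := tiltedArgmin_addLoss hm hn hH hL v
  set W0 := tiltedArgmin n H
  set W1 := tiltedArgmin n fun u => H u + L (inner ℝ u v) / n
  rw [Measure.map_apply hW0 hT, Measure.map_apply hW1 hT, expNormLaw_apply (hW0 hT),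
    expNormLaw_apply (hW1 hT)]
  set h : Vec d → ℝ≥0∞ := fun b => ENNReal.ofReal (Real.exp (-(c * ‖b‖)))
  have hmeas : Measurable h := by fun_prop
  set f : Vec d → ℝ := fun b => -p (inner ℝ (W0 b) v)
  have hf : Measurable f :=
    (hL.mono.measurable.comp (hW0.inner measurable_const)).neg
  have hdist : ∀ b, ‖b + f b • v - b‖ ≤ 1 := fun b => by
    rw [add_sub_cancel_left, norm_smul]
    refine mul_le_one₀ ?_ (norm_nonneg _) hv
    simpa [f] using hL.bound (inner ℝ (W0 b) v)
  have hpos : 0 < (4 * n * m)⁻¹ := by positivity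
  obtain ⟨hle, hge⟩ := lintegral_shear (volume : Measure (Vec d)) hf
    (fun b => hasSlopes_shift hm hn hH hL hv b)
    (by rw [Real.one_le_toNNReal]; linarith)
    (hmeas.indicator (hW1 hT))
  -- The shear carries the event for `W0` to the event for `W1`, so only the density changes.
  have hind : ∀ b, (W1 ⁻¹' T).indicator h (b + f b • v)
      = (W0 ⁻¹' T).indicator (fun b => h (b + f b • v)) b := fun b => by
    have hiff : b + f b • v ∈ W1 ⁻¹' T ↔ b ∈ W0 ⁻¹' T := by
      rw [Set.mem_preimage, hψ b, Set.mem_preimage]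
    by_cases hb : b ∈ W0 ⁻¹' T
    · rw [Set.indicator_of_mem hb, Set.indicator_of_mem (hiff.2 hb)]
    · rw [Set.indicator_of_notMem hb, Set.indicator_of_notMem (mt hiff.1 hb)]
  simp only [hind] at hle hge
  have hc1 : ∫⁻ b, (W0 ⁻¹' T).indicator h b ≤ ENNReal.ofReal (Real.exp c) *
      ∫⁻ b, (W0 ⁻¹' T).indicator (fun b => h (b + f b • v)) b := by
    rw [← lintegral_const_mul' _ _ ENNReal.ofReal_ne_top]
    refine lintegral_mono fun b => ?_
    by_cases hb : b ∈ W0 ⁻¹' T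
    · simp only [Set.indicator_of_mem hb]
      exact exp_norm_le hc (by rw [norm_sub_rev]; exact hdist b)
    · simp [Set.indicator_of_notMem hb]
  have hc2 : ∫⁻ b, (W0 ⁻¹' T).indicator (fun b => h (b + f b • v)) b ≤
      ENNReal.ofReal (Real.exp c) * ∫⁻ b, (W0 ⁻¹' T).indicator h b := by
    rw [← lintegral_const_mul' _ _ ENNReal.ofReal_ne_top]
    refine lintegral_mono fun b => ?_
    by_cases hb : b ∈ W0 ⁻¹' T
    · simp only [Set.indicator_of_mem hb]
      exact exp_norm_le hc (hdist b)
    · simp [Set.indicator_of_notMem hb]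
  constructor
  · rw [mul_left_comm]
    gcongr
    exact hc1.trans (by gcongr)
  · rw [mul_left_comm _ (_⁻¹), mul_left_comm _ (_⁻¹)]
    gcongr
    exact hge.trans (mul_le_mul_right hc2 _)

end AddLoss
-- Privacy of PLR.
section Plr

variable {ι : Type} {d : ℕ}

/-- The regularizing part of the objective. -/
noncomputable def regTerm (lam Δ : ℝ) (g : Vec d → ℝ) (w : Vec d) : ℝ :=
  Δ * ‖w‖ ^ 2 / 2 + lam * g w

/-- Subtracting `(Δ + λ)/2 ‖w‖²` cancels the `Δ` term and leaves `λ (g - ‖w‖²/2)`, so the sign of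
`Δ` does not matter. -/
theorem strongConvexOn_regTerm {lam Δ : ℝ} (hlam : 0 ≤ lam) {g : Vec d → ℝ}
    (hg : StrongConvexOn Set.univ 1 g) : StrongConvexOn Set.univ (Δ + lam) (regTerm lam Δ g) := by
  rw [strongConvexOn_iff_convex] at hg ⊢
  have := hg.smul hlam
  convert! this using 2 with w
  simp only [regTerm, smul_eq_mul]
  ring

theorem convexOn_dataTerm {n : ℝ} (hn : 0 < n) (D : ι → Sample d) (S : Finset ι) :
    ConvexOn ℝ Set.univ fun w : Vec d =>
      ∑ i ∈ S, logisticLoss (inner ℝ w (D i).1) (D i).2 / n := by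
  classical
  induction S using Finset.induction_on with
  | empty => simpa using convexOn_const (0 : ℝ) convex_univ
  | insert i S hi ih =>
    simp only [Finset.sum_insert hi]
    exact ((isSmoothLoss_logisticLoss (D i).2.2).convexOn_comp_inner (D i).1 hn).add ih

variable [Fintype ι]

theorem objective_eq (lam Δ : ℝ) (g : Vec d → ℝ) (D : ι → Sample d) (b w : Vec d) :
    objective lam Δ g D b w = regTerm lam Δ g w +
      ∑ i, logisticLoss (inner ℝ w (D i).1) (D i).2 / (Fintype.card ι : ℝ)
      + inner ℝ b w / (Fintype.card ι : ℝ) := by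
  rw [objective, regTerm, ← Finset.sum_div]
  ring

theorem argmin_objective_eq (lam Δ : ℝ) (g : Vec d → ℝ) (D : ι → Sample d) :
    (fun b => argmin (objective lam Δ g D b)) = tiltedArgmin (Fintype.card ι) fun w =>
      regTerm lam Δ g w + ∑ i, logisticLoss (inner ℝ w (D i).1) (D i).2 / (Fintype.card ι : ℝ) := by
  funext b
  rw [tiltedArgmin]
  exact congrArg argmin (funext fun w => objective_eq lam Δ g D b w)

theorem argmin_objective_eq_addLoss [DecidableEq ι] (lam Δ : ℝ) (g : Vec d → ℝ)
    (D : ι → Sample d) (i : ι) :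
    (fun b => argmin (objective lam Δ g D b)) = tiltedArgmin (Fintype.card ι) fun w =>
      (regTerm lam Δ g w + ∑ j ∈ Finset.univ.erase i,
          logisticLoss (inner ℝ w (D j).1) (D j).2 / (Fintype.card ι : ℝ))
        + logisticLoss (inner ℝ w (D i).1) (D i).2 / (Fintype.card ι : ℝ) := by
  rw [argmin_objective_eq]
  refine congrArg _ (funext fun w => ?_)
  rw [add_assoc, Finset.sum_erase_add _ _ (Finset.mem_univ i)]

theorem strongConvexOn_objective [Nonempty ι] {lam Δ : ℝ} (hlam : 0 ≤ lam) {g : Vec d → ℝ}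
    (hg : StrongConvexOn Set.univ 1 g) (D : ι → Sample d) (b : Vec d) :
    StrongConvexOn Set.univ (Δ + lam) (objective lam Δ g D b) := by
  have hn : (0 : ℝ) < Fintype.card ι := by exact_mod_cast Fintype.card_pos
  have h := strongConvexOn_tilt (n := Fintype.card ι) (StrongConvexOn.add_convexOn
    (strongConvexOn_regTerm (Δ := Δ) hlam hg) (convexOn_dataTerm hn D Finset.univ)) b
  rwa [← funext fun w => objective_eq lam Δ g D b w] at h

/-- The output of PLR is a continuous function of the noise vector and the scaled samples. -/
theorem continuous_argmin_objective [Nonempty ι] {lam Δ : ℝ} (hlam : 0 ≤ lam)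
    (hm : 0 < Δ + lam) {g : Vec d → ℝ} (hg : StrongConvexOn Set.univ 1 g)
    (y : ι → Set.Icc (-1 : ℝ) 1) :
    Continuous fun z : (ι → Vec d) × Vec d =>
      argmin (objective lam Δ g (fun i => (z.1 i, y i)) z.2) := by
  have hn : (0 : ℝ) < Fintype.card ι := by exact_mod_cast Fintype.card_pos
  refine continuous_argmin hm (fun z => strongConvexOn_objective hlam hg _ z.2)
    (fun z z' => (∑ i, ‖z.1 i - z'.1 i‖ + ‖z.2 - z'.2‖) / Fintype.card ι)
    (fun z z' u => ?_) fun z => ?_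
  · have heq : objective lam Δ g (fun i => (z.1 i, y i)) z.2 u
        - objective lam Δ g (fun i => (z'.1 i, y i)) z'.2 u
        = (∑ i, (logisticLoss (inner ℝ u (z.1 i)) (y i) - logisticLoss (inner ℝ u (z'.1 i)) (y i))
          + inner ℝ (z.2 - z'.2) u) / Fintype.card ι := by
      rw [Finset.sum_sub_distrib, inner_sub_left, objective, objective]
      ring
    rw [heq, abs_div, abs_of_pos hn, div_mul_eq_mul_div, add_mul, Finset.sum_mul]
    gcongr
    refine (abs_add_le _ _).trans (add_le_add ?_ (abs_real_inner_le_norm _ _))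
    refine (Finset.abs_sum_le_sum_abs _ _).trans (Finset.sum_le_sum fun i _ => ?_)
    refine ((isSmoothLoss_logisticLoss (y i).2).abs_sub_le _ _).trans ?_
    rw [← inner_sub_right, mul_comm]
    exact abs_real_inner_le_norm _ _
  · have : Continuous fun z' : (ι → Vec d) × Vec d =>
        (∑ i, ‖z.1 i - z'.1 i‖ + ‖z.2 - z'.2‖) / (Fintype.card ι : ℝ) := by fun_prop
    simpa using this.tendsto z

/-- The accounting of the privacy budget in PLR. -/
theorem budget {ε lam : ℝ} (hε : 0 < ε) {n : ℕ} (hn : 0 < n) :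
    0 < modifiedBudget ε lam n ∧ 0 < extraWeight ε lam n + lam ∧
      Real.exp (modifiedBudget ε lam n) * (1 + (4 * n * (extraWeight ε lam n + lam))⁻¹)
        ≤ Real.exp ε := by
  have hn' : (0 : ℝ) < n := by exact_mod_cast hn
  by_cases h : SlackPositive ε lam n
  · simp only [modifiedBudget, extraWeight, if_pos h, zero_add]
    have hl := h.1
    refine ⟨h.2, hl, ?_⟩
    have hA : 1 + 1 / (2 * (n : ℝ) * lam) + 1 / (16 * (n : ℝ) ^ 2 * lam ^ 2)
        = (1 + (4 * n * lam)⁻¹) ^ 2 := by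
      field_simp
      ring
    have h1 : 0 < (4 * n * lam)⁻¹ := by positivity
    rw [hA, Real.exp_sub, Real.exp_log (by positivity)]
    set A := 1 + (4 * n * lam)⁻¹
    -- The test reserves a factor `A²`, of which only one `A` is spent.
    have hA1 : 1 ≤ A := by simp only [A]; linarith
    rw [div_mul_eq_mul_div, div_le_iff₀ (by positivity)]
    gcongr
    nlinarith
  · simp only [modifiedBudget, extraWeight, if_neg h, sub_add_cancel]
    have h1 : 0 < Real.exp (ε / 4) - 1 := by
      rw [sub_pos]; exact Real.one_lt_exp_iff.2 (by linarith)
    refine ⟨by linarith, by positivity, ?_⟩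
    -- `Δ` is chosen to make the volume factor `e^(ε/4)`; with `ε' = ε/2` the total is `e^(3ε/4)`.
    have h2 : 1 + (4 * n * (4 * n * (Real.exp (ε / 4) - 1))⁻¹)⁻¹ = Real.exp (ε / 4) := by
      field_simp
      ring
    rw [h2, ← Real.exp_add]
    exact Real.exp_le_exp.2 (by linarith)

theorem measurable_argmin_objective [Nonempty ι] {lam Δ : ℝ} (hlam : 0 ≤ lam)
    (hm : 0 < Δ + lam) {g : Vec d → ℝ} (hg : StrongConvexOn Set.univ 1 g) (D : ι → Sample d) :
    Measurable fun b => argmin (objective lam Δ g D b) :=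
  ((continuous_argmin_objective hlam hm hg fun i => (D i).2).comp
    (Continuous.prodMk_right fun i => (D i).1)).measurable

/-- PLR is differentially private. -/
theorem isDifferentiallyPrivate_plr [Nonempty ι] {ε lam : ℝ} (hε : 0 < ε) (hlam : 0 ≤ lam)
    {g : Vec d → ℝ} (hg : StrongConvexOn Set.univ 1 g) (s : ScalingRule d) :
    IsDifferentiallyPrivate ε (plr (ι := ι) ε lam g s) := by
  classical
  have hn : (0 : ℝ) < Fintype.card ι := by exact_mod_cast Fintype.card_pos
  obtain ⟨hε', hm, hbudget⟩ := budget (lam := lam) hε (Fintype.card_pos (α := ι))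
  have hc : 0 < modifiedBudget ε lam (Fintype.card ι) / 2 := half_pos hε'
  refine ⟨fun D => ?_, ?_⟩
  · have := isProbabilityMeasure_expNormLaw (d := d) hc
    exact Measure.isProbabilityMeasure_map
      (measurable_argmin_objective hlam hm hg _).aemeasurable
  rintro D D' ⟨i, hi⟩ T hT
  rw [plr, plr, argmin_objective_eq_addLoss _ _ _ _ i, argmin_objective_eq_addLoss _ _ _ _ i]
  set n : ℝ := (Fintype.card ι : ℝ)
  set c := modifiedBudget ε lam (Fintype.card ι) / 2 with hcdef
  set m := extraWeight ε lam (Fintype.card ι) + lam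
  have hsum : ∀ w : Vec d, ∑ j ∈ Finset.univ.erase i,
      logisticLoss (inner ℝ w (s.apply (D' j)).1) (s.apply (D' j)).2 / n
      = ∑ j ∈ Finset.univ.erase i,
        logisticLoss (inner ℝ w (s.apply (D j)).1) (s.apply (D j)).2 / n := fun w =>
    Finset.sum_congr rfl fun j hj => by rw [hi j (Finset.ne_of_mem_erase hj)]
  simp only [hsum]
  have hH := StrongConvexOn.add_convexOn
    (strongConvexOn_regTerm (Δ := extraWeight ε lam (Fintype.card ι)) hlam hg)
    (convexOn_dataTerm hn (fun j => s.apply (D j)) (Finset.univ.erase i))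
  -- Pass from `D` to the objective lacking sample `i`, then to `D'`. Since the shear never
  -- contracts, only the deletion costs the volume factor.
  have h1 := (map_tiltedArgmin_addLoss hm hn hH (isSmoothLoss_logisticLoss (s.apply (D i)).2.2)
    (s.norm_le_one (D i).1) hc.le hT).2
  have h2 := (map_tiltedArgmin_addLoss hm hn hH (isSmoothLoss_logisticLoss (s.apply (D' i)).2.2)
    (s.norm_le_one (D' i).1) hc.le hT).1
  refine (h1.trans (mul_le_mul_right (mul_le_mul_right h2 _) _)).trans ?_
  rw [← mul_assoc, ← mul_assoc, ← ENNReal.ofReal_mul (by positivity),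
    ← ENNReal.ofReal_mul (by positivity)]
  refine mul_le_mul_left (ENNReal.ofReal_le_ofReal (le_trans (le_of_eq ?_) hbudget)) _
  rw [mul_assoc, ← Real.exp_add, ← two_mul, hcdef, mul_div_cancel₀ _ two_ne_zero, mul_comm]

end Plr

/-! ### Measurability and composition of the two levels. -/

section Composition

theorem measurable_map_of_uncurry {α β γ : Type*} [MeasurableSpace α] [MeasurableSpace β]
    [MeasurableSpace γ] (ν : Measure β) [SFinite ν] {G : α × β → γ} (hG : Measurable G) :
    Measurable fun a => ν.map fun b => G (a, b) := by
  refine Measure.measurable_of_measurable_coe _ fun s hs => ?_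
  have : (fun a => (ν.map fun b => G (a, b)) s) = fun a => ν (Prod.mk a ⁻¹' (G ⁻¹' s)) :=
    funext fun a => Measure.map_apply (hG.comp measurable_prodMk_left) hs
  rw [this]
  exact measurable_measure_prodMk_left (hG hs)

/-- Splitting off coordinate `k` reduces this to monotonicity of a binary product. -/
theorem pi_le_smul_pi {K : ℕ} {α : Fin K → Type*} [∀ k, MeasurableSpace (α k)]
    (μ ν : ∀ k, Measure (α k)) [∀ k, SigmaFinite (μ k)] [∀ k, SigmaFinite (ν k)] (k : Fin K)
    (h : ∀ j, j ≠ k → μ j = ν j) {c : ℝ≥0∞} (hk : μ k ≤ c • ν k) :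
    Measure.pi μ ≤ c • Measure.pi ν := by
  cases K with
  | zero => exact k.elim0
  | succ K =>
    rw [← (measurePreserving_piFinSuccAbove μ k).symm.map_eq,
      ← (measurePreserving_piFinSuccAbove ν k).symm.map_eq, ← Measure.map_smul,
      ← Measure.prod_smul_left]
    have : (fun j => μ (k.succAbove j)) = fun j => ν (k.succAbove j) :=
      funext fun j => h _ (Fin.succAbove_ne k j)
    simp only [this]
    exact Measure.map_mono (Measure.prod_mono hk le_rfl) (MeasurableEquiv.measurable _)

variable {K d : ℕ} {ε lam : ℝ} {gHigh : Vec K → ℝ}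

theorem measurable_scaled_metaSample (sHigh : ScalingRule K) (z : Sample d) :
    Measurable fun w : Fin K → Vec d => (sHigh.apply (metaSample w z)).1 := by
  have h : Measurable fun w : Fin K → Vec d => (metaSample w z).1 := by
    have : Continuous fun w : Fin K → Vec d => (metaSample w z).1 := by
      unfold metaSample
      fun_prop
    exact this.measurable
  exact (sHigh.measurable_factor.comp h).smul h

/-- The high-level stage of PST-S, with the low-level parameters kept, is a measurable family of
laws. -/
theorem measurable_highLevel {ι : Type} [Fintype ι] [Nonempty ι] (hε : 0 < ε) (hlam : 0 ≤ lam)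
    (hg : StrongConvexOn Set.univ 1 gHigh) (sHigh : ScalingRule K) (D : ι → Sample d) :
    Measurable fun w : Fin K → Vec d =>
      (plr ε lam gHigh sHigh fun i => metaSample w (D i)).map fun v => (w, v) := by
  obtain ⟨hε', hm, -⟩ := budget (lam := lam) hε (Fintype.card_pos (α := ι))
  have := isProbabilityMeasure_expNormLaw (d := K) (half_pos hε')
  have happly : ∀ (w : Fin K → Vec d) (i : ι), sHigh.apply (metaSample w (D i))
      = ((sHigh.apply (metaSample w (D i))).1, (D i).2) := fun w i => rfl
  have hG : Measurable fun z : (Fin K → Vec d) × Vec K =>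
      (z.1, argmin (objective lam (extraWeight ε lam (Fintype.card ι)) gHigh
        (fun i => ((sHigh.apply (metaSample z.1 (D i))).1, (D i).2)) z.2)) := by
    refine measurable_fst.prodMk ?_
    have hX : Measurable fun z : (Fin K → Vec d) × Vec K =>
        ((fun i => (sHigh.apply (metaSample z.1 (D i))).1, z.2) : (ι → Vec K) × Vec K) :=
      (measurable_pi_lambda _ fun i =>
        (measurable_scaled_metaSample sHigh (D i)).comp measurable_fst).prodMk measurable_snd
    have hA := (continuous_argmin_objective hlam hm hg fun i => (D i).2).measurable
    have hAX := hA.comp hX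
    simpa only [Function.comp_def] using hAX
  -- The noise law does not depend on `w`, so the family is the image of one fixed law under a
  -- jointly measurable map.
  convert! measurable_map_of_uncurry (expNormLaw K (modifiedBudget ε lam (Fintype.card ι) / 2)) hG
    using 2 with w
  rw [plr, Measure.map_map measurable_prodMk_left (measurable_argmin_objective hlam hm hg _)]
  simp only [← happly]
  rfl

end Composition
end PrivStack

theorem mainTheorem3 (N K d : ℕ) (ε lam : ℝ) (hε : 0 < ε) (hlam : 0 ≤ lam)
    (gLow : PrivStack.Vec d → ℝ) (gHigh : PrivStack.Vec K → ℝ)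
    (hgLow : StrongConvexOn Set.univ 1 gLow) (hgHigh : StrongConvexOn Set.univ 1 gHigh)
    (sLow : PrivStack.ScalingRule d) (sHigh : PrivStack.ScalingRule K)
    (part : Fin N → Option (Fin K)) (hpart : Function.Surjective part) :
    PrivStack.IsDifferentiallyPrivate ε
      (PrivStack.pstS ε lam gLow gHigh sLow sHigh part) := by
  open PrivStack in
  have hne : ∀ p, Nonempty {i : Fin N // part i = p} := fun p =>
    let ⟨i, hi⟩ := hpart p; ⟨⟨i, hi⟩⟩
  have hlow := fun k => isDifferentiallyPrivate_plr (ι := {i : Fin N // part i = some k})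
    hε hlam hgLow sLow
  have hhigh := isDifferentiallyPrivate_plr (ι := {i : Fin N // part i = none})
    hε hlam hgHigh sHigh
  have hprobLow := fun k => (hlow k).1
  have hprobHigh := hhigh.1
  have hmeas := fun D => measurable_highLevel (K := K) (d := d) hε hlam hgHigh sHigh
    (subData part none D)
  have hsub : ∀ D D' : Fin N → Sample d, ∀ i, (∀ j, j ≠ i → D j = D' j) → ∀ p, part i ≠ p →
      subData part p D = subData part p D' := fun D D' i hi p hp =>
    funext fun j => hi j fun hj => hp (hj ▸ j.2)
  refine ⟨fun D => ⟨?_⟩, ?_⟩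
  · rw [pstS, Measure.bind_apply MeasurableSet.univ (hmeas D).aemeasurable]
    simp [Measure.map_apply measurable_prodMk_left MeasurableSet.univ]
  rintro D D' ⟨i, hi⟩ T hT
  rw [pstS, pstS, Measure.bind_apply hT (hmeas D).aemeasurable,
    Measure.bind_apply hT (hmeas D').aemeasurable]
  -- If `i` is high-level, the low-level laws agree and the bound holds for each fixed `w`, since
  -- each meta-sample uses only its own sample. If `i` is low-level, one factor of the product law
  -- changes and the high-level kernel stays the same.
  rcases hp : part i with _ | k
  · have hlowEq : ∀ k, subData part (some k) D = subData part (some k) D' := fun k =>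
      hsub D D' i hi _ (by simp [hp])
    simp only [hlowEq]
    rw [← lintegral_const_mul' _ _ ENNReal.ofReal_ne_top]
    refine lintegral_mono fun w => ?_
    rw [Measure.map_apply measurable_prodMk_left hT, Measure.map_apply measurable_prodMk_left hT]
    refine hhigh.2 _ _ ⟨⟨i, hp⟩, fun j hj => ?_⟩ _ (measurable_prodMk_left hT)
    have : D j = D' j := hi j fun h => hj (Subtype.ext h)
    simp only [subData, this]
  · rw [hsub D D' i hi none (by simp [hp])]
    rw [← smul_eq_mul, ← lintegral_smul_measure]
    refine lintegral_mono' (pi_le_smul_pi _ _ k (fun j hj => ?_) ?_) le_rfl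
    · rw [hsub D D' i hi (some j) (by simpa [hp] using hj.symm)]
    · refine Measure.le_iff.2 fun S hS => ?_
      exact (hlow k).2 _ _ ⟨⟨i, hp⟩, fun j hj => hi j fun h => hj (Subtype.ext h)⟩ S hS
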